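/- Let $M$ be a smooth finite-dimensional manifold with a pseudo-Riemannian metric $g$ (a smooth symmetric non-degenerate $(0,2)$-tensor field). Let $TM=(V_{p_s}\oplus V_{p_s^*})\overset{\perp}{\oplus}\cdots\overset{\perp}{\oplus}(V_{p_1}\oplus V_{p_1^*})\overset{\perp}{\oplus}V_{q_1}\overset{\perp}{\oplus}\cdots\overset{\perp}{\oplus}V_{q_r}$ be a Witt structure: the $V_i$ are smooth subbundles of constant rank, $V_{p_k}$ and $V_{p_k^*}$ have the same rank, are totally isotropic and are paired non-degenerately by $g$, and each $V_{q_l}$ is anisotropic. Write $\pi^i$ for the projection of $TM$ onto $V_i$ given by this decomposition, $v_i=\pi^i(v)$, and let $i\mapsto i^*$ be the involution of the index set that exchanges $p_k$ and $p_k^*$ and fixes each $q_l$. Let $\flat,\sharp$ be the musical isomorphisms of $g$ and $\mathcal L$ the Lie derivative. Let $\nabla$ be the canonical Witt connection, that is, the connection on $TM$ such that $\nabla g=0$, $\nabla(\Gamma(V_i))\subset\Gamma(V_i)$ for every $i$, and whose torsion $T(X,Y)=\nabla_XY-\nabla_YX-[X,Y]$ satisfies, for all sections $X_i$ of $V_i$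 and $Y_j$ of $V_j$, $$T(X_i,Y_j)=-\sum_{k\ne i,j}[X_i,Y_j]_k+\tau^j(X_i,Y_j)-\tau^i(Y_j,X_i),$$ where $\tau^j(X_i,Y_j)=0$ if $i=j$, $$\tau^j(X_i,Y_j)=\tfrac12\Big(\big(\mathcal L_{X_i}Y_j^\flat+\mathcal L_{Y_j}X_i^\flat\big)^\sharp_j-[X_i,Y_j]_j-\big(d(g(X_i,Y_j))\big)^\sharp_j\Big)\quad\text{if } i\neq j,\ i=j^*,$$ $$\tau^j(X_i,Y_j)=\tfrac12\Big(\big(\mathcal L_{X_i}Y_j^\flat\big)^\sharp_j-[X_i,Y_j]_j\Big)\quad\text{if } i\neq j,\ i\ne j^*.$$ Let $U\subset M$ be open and let $\psi:U\to M$ be a local Witt isometry, that is, a smooth local diffeomorphism such that, for every $x\in U$, $g_{\psi(x)}(d\psi_x v,d\psi_x w)=g_x(v,w)$ for all $v,w\in T_xM$, and $d\psi_x\circ\pi^i_x=\pi^i_{\psi(x)}\circ d\psi_x$ for every $i$. Then $\psi$ is a local Witt affine diffeomorphism: $\psi^*\nabla=\nabla$ on $U$, where locally $(\psi^*\nabla)_XY=d\psi^{-1}\big(\nabla_{d\psi(X)}d\psi(Y)\big)$.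 Equivalently, $(\nabla_Xd\psi)(Y)=\nabla_{d\psi(X)}d\psi(Y)-d\psi(\nabla_XY)=0$ on $U$ for all smooth vector fields $X,Y$. -/

import Mathlib

open Bundle Set VectorField
open scoped Manifold ContDiff Topology

noncomputable section

namespace WittGeometry

section PseudoRiemannian

variable (E : Type*) [NormedAddCommGroup E] [NormedSpace ℝ E]
  (M : Type*) [TopologicalSpace M] [ChartedSpace E M]

/-- A (not necessarily smooth) vector field on the manifold `M` modelled on `E`. -/
abbrev VField : Type _ := Π x : M, TangentSpace 𝓘(ℝ, E) x

variable {E M} [IsManifold 𝓘(ℝ, E) ∞ M]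

/-- `X` is a smooth vector field on the set `W` (used for open sets `W`; the values of `X`
outside `W` play no role). -/
def SmoothFieldOn (X : VField E M) (W : Set M) : Prop :=
  ContMDiffOn 𝓘(ℝ, E) (𝓘(ℝ, E).prod 𝓘(ℝ, E)) ∞
    (fun y ↦ TotalSpace.mk' E (E := fun z : M ↦ TangentSpace 𝓘(ℝ, E) z) y (X y)) W

variable (E M)

/-- A pseudo-Riemannian metric: a smooth, symmetric, non-degenerate `(0,2)`-tensor field. -/
structure PseudoRiemannianMetric where
  /-- The scalar product on each tangent space. -/
  inner (x : M) :
    TangentSpace 𝓘(ℝ, E) x →L[ℝ] TangentSpace 𝓘(ℝ, E) x →L[ℝ] ℝ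
  symm (x : M) (v w : TangentSpace 𝓘(ℝ, E) x) : inner x v w = inner x w v
  nondegenerate (x : M) (v : TangentSpace 𝓘(ℝ, E) x) (hv : ∀ w, inner x v w = 0) : v = 0
  contMDiff : ContMDiff 𝓘(ℝ, E) (𝓘(ℝ, E).prod 𝓘(ℝ, E →L[ℝ] E →L[ℝ] ℝ)) ∞
    (fun x ↦ TotalSpace.mk' (E →L[ℝ] E →L[ℝ] ℝ)
      (E := fun z : M ↦ TangentSpace 𝓘(ℝ, E) z →L[ℝ] TangentSpace 𝓘(ℝ, E) z →L[ℝ] ℝ)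
      x (inner x))

variable {E M}

/-- A family of subspaces of the tangent spaces is a smooth subbundle of rank `k` if near each
point it has a frame of `k` smooth sections. -/
def IsSmoothSubbundle (V : Π x : M, Submodule ℝ (TangentSpace 𝓘(ℝ, E) x)) (k : ℕ) : Prop :=
  ∀ x : M, ∃ W : Set M, IsOpen W ∧ x ∈ W ∧ ∃ e : Fin k → VField E M,
    (∀ a, SmoothFieldOn (e a) W) ∧
    ∀ y ∈ W, LinearIndependent ℝ (fun a ↦ e a y) ∧
      Submodule.span ℝ (range fun a ↦ e a y) = V y

/-- `X` is a smooth section over `W` of the family of subspaces `V`. -/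
def IsSectionOn (V : Π x : M, Submodule ℝ (TangentSpace 𝓘(ℝ, E) x))
    (X : VField E M) (W : Set M) : Prop :=
  SmoothFieldOn X W ∧ ∀ y ∈ W, X y ∈ V y

end PseudoRiemannian

/-- The index set `{p_1, …, p_s} ⊔ {p_1^*, …, p_s^*} ⊔ {q_1, …, q_r}` of a Witt structure. -/
abbrev Index (r s : ℕ) : Type := (Fin s ⊕ Fin s) ⊕ Fin r

namespace Index

variable {r s : ℕ}

/-- The index `p_k`. -/
abbrev p (k : Fin s) : Index r s := Sum.inl (Sum.inl k)

/-- The index `p_k^*`. -/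
abbrev pstar (k : Fin s) : Index r s := Sum.inl (Sum.inr k)

/-- The index `q_l`. -/
abbrev q (l : Fin r) : Index r s := Sum.inr l

/-- The involution `i ↦ i^*`: it exchanges `p_k` and `p_k^*` and fixes each `q_l`. -/
def star : Index r s → Index r s
  | Sum.inl (Sum.inl k) => pstar k
  | Sum.inl (Sum.inr k) => p k
  | Sum.inr l => q l

end Index

section WittStructure

variable {E : Type*} [NormedAddCommGroup E] [NormedSpace ℝ E]
  {M : Type*} [TopologicalSpace M] [ChartedSpace E M] [IsManifold 𝓘(ℝ, E) ∞ M]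

/-- A Witt structure on the tangent bundle of a pseudo-Riemannian manifold: subbundles `V_i` with
`TM = (V_{p_s} ⊕ V_{p_s^*}) ⊥ … ⊥ (V_{p_1} ⊕ V_{p_1^*}) ⊥ V_{q_1} ⊥ … ⊥ V_{q_r}`, where `V_{p_k}`
and `V_{p_k^*}` are totally isotropic and paired non-degenerately by the metric, and the
`V_{q_l}` are anisotropic. -/
structure WittStructure (g : PseudoRiemannianMetric E M) (r s : ℕ) where
  /-- The subbundles. -/
  V : Index r s → Π x : M, Submodule ℝ (TangentSpace 𝓘(ℝ, E) x)
  /-- Their ranks. -/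
  rank : Index r s → ℕ
  isSmoothSubbundle (i : Index r s) : IsSmoothSubbundle (V i) (rank i)
  isInternal (x : M) : DirectSum.IsInternal fun i ↦ V i x
  orthogonal (i j : Index r s) (hij : j ≠ i) (hij' : j ≠ i.star) (x : M) :
    ∀ v ∈ V i x, ∀ w ∈ V j x, g.inner x v w = 0
  rank_eq (k : Fin s) : rank (Index.p k) = rank (Index.pstar k)
  isotropic_p (k : Fin s) (x : M) :
    ∀ v ∈ V (Index.p k) x, ∀ w ∈ V (Index.p k) x, g.inner x v w = 0
  isotropic_pstar (k : Fin s) (x : M) :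
    ∀ v ∈ V (Index.pstar k) x, ∀ w ∈ V (Index.pstar k) x, g.inner x v w = 0
  nondegenerate_left (k : Fin s) (x : M) :
    ∀ v ∈ V (Index.p k) x, (∀ w ∈ V (Index.pstar k) x, g.inner x v w = 0) → v = 0
  nondegenerate_right (k : Fin s) (x : M) :
    ∀ w ∈ V (Index.pstar k) x, (∀ v ∈ V (Index.p k) x, g.inner x v w = 0) → w = 0
  anisotropic (l : Fin r) (x : M) :
    ∀ v ∈ V (Index.q l) x, g.inner x v v = 0 → v = 0

/-- The projection `π^i_x` of `T_x M` onto `V_{i,x}` (as an endomorphism of `T_x M`) along the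
other summands. -/
def WittStructure.proj {g : PseudoRiemannianMetric E M} {r s : ℕ} (S : WittStructure g r s)
    (i : Index r s) (x : M) : TangentSpace 𝓘(ℝ, E) x →ₗ[ℝ] TangentSpace 𝓘(ℝ, E) x :=
  (S.V i x).subtype ∘ₗ
    DirectSum.component ℝ (Index r s) (fun j ↦ S.V j x) i ∘ₗ
    (LinearEquiv.ofBijective (DirectSum.coeLinearMap fun j ↦ S.V j x)
      (S.isInternal x)).symm.toLinearMap

end WittStructure

section Connection

variable {E : Type*} [NormedAddCommGroup E] [NormedSpace ℝ E] [FiniteDimensional ℝ E]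
  {M : Type*} [TopologicalSpace M] [ChartedSpace E M] [IsManifold 𝓘(ℝ, E) ∞ M]

/-- The `1`-form `X^♭ = g(X, ·)`. -/
def PseudoRiemannianMetric.flat (g : PseudoRiemannianMetric E M) (X : VField E M) (x : M) :
    TangentSpace 𝓘(ℝ, E) x →L[ℝ] ℝ :=
  g.inner x (X x)

/-- The musical isomorphism `v ↦ g_x(v, ·)` from `T_x M` to its dual. -/
def PseudoRiemannianMetric.flatEquiv (g : PseudoRiemannianMetric E M) (x : M) :
    TangentSpace 𝓘(ℝ, E) x ≃ₗ[ℝ] (TangentSpace 𝓘(ℝ, E) x →L[ℝ] ℝ) :=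
  haveI : FiniteDimensional ℝ (TangentSpace 𝓘(ℝ, E) x) :=
    inferInstanceAs (FiniteDimensional ℝ E)
  haveI : T2Space (TangentSpace 𝓘(ℝ, E) x) := inferInstanceAs (T2Space E)
  LinearMap.linearEquivOfInjective (g.inner x).toLinearMap
    ((injective_iff_map_eq_zero _).2 fun v hv ↦
      g.nondegenerate x v fun w ↦ congrArg (fun φ : TangentSpace 𝓘(ℝ, E) x →L[ℝ] ℝ ↦ φ w) hv)
    (by
      rw [← (LinearMap.toContinuousLinearMap (𝕜 := ℝ)
        (E := TangentSpace 𝓘(ℝ, E) x) (F' := ℝ)).finrank_eq]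
      exact (Subspace.dual_finrank_eq (K := ℝ) (V := TangentSpace 𝓘(ℝ, E) x)).symm)

/-- The vector `φ^♯`, characterised by `g_x(φ^♯, w) = φ w`. -/
def PseudoRiemannianMetric.sharp (g : PseudoRiemannianMetric E M) (x : M)
    (φ : TangentSpace 𝓘(ℝ, E) x →L[ℝ] ℝ) : TangentSpace 𝓘(ℝ, E) x :=
  (g.flatEquiv x).symm φ

/-- The operator `Z ↦ X(α(Z)) - α([X, Z])` on vector fields, evaluated at `x`. -/
def lieDerivAux (X : VField E M) (α : Π x : M, TangentSpace 𝓘(ℝ, E) x →L[ℝ] ℝ) (x : M)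
    (Z : VField E M) : ℝ :=
  mvfderiv 𝓘(ℝ, E) (fun y ↦ α y (Z y)) x (X x) - α x (mlieBracket 𝓘(ℝ, E) X Z x)

open Classical in
/-- The Lie derivative `L_X α` of a `1`-form, the `1`-form with
`(L_X α)(Z) = X(α(Z)) - α([X, Z])`. The right-hand side is tensorial in `Z` at every point at which
`X` and `α` are differentiable; the value elsewhere is irrelevant. -/
def lieDeriv (X : VField E M) (α : Π x : M, TangentSpace 𝓘(ℝ, E) x →L[ℝ] ℝ) (x : M) :
    TangentSpace 𝓘(ℝ, E) x →L[ℝ] ℝ :=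
  if h : TensorialAt 𝓘(ℝ, E) E (lieDerivAux X α x) x then
    TensorialAt.mkHom (lieDerivAux X α x) x h
  else 0

/-- An affine connection on `M`. The value at `x` on the field `Y` and the vector `v` is
`∇ Y x v = ∇_v Y`. -/
abbrev Connection (E : Type*) [NormedAddCommGroup E] [NormedSpace ℝ E]
    (M : Type*) [TopologicalSpace M] [ChartedSpace E M] [IsManifold 𝓘(ℝ, E) ∞ M] : Type _ :=
  CovariantDerivative 𝓘(ℝ, E) E (fun x : M ↦ TangentSpace 𝓘(ℝ, E) x)

/-- The torsion tensor `T(X, Y) = ∇_X Y - ∇_Y X - [X, Y]`. -/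
def torsion (D : Connection E M) (x : M) :
    TangentSpace 𝓘(ℝ, E) x →L[ℝ] TangentSpace 𝓘(ℝ, E) x →L[ℝ] TangentSpace 𝓘(ℝ, E) x :=
  haveI : CompleteSpace E := FiniteDimensional.complete ℝ E
  CovariantDerivative.torsion D x

variable {g : PseudoRiemannianMetric E M} {r s : ℕ}

/-- The tensor `τ^k(X_i, Y_j)`, evaluated at `x`, for sections `X` of `V_i` and `Y` of `V_j`. -/
def WittStructure.tau (S : WittStructure g r s) (k i j : Index r s) (X Y : VField E M) (x : M) :
    TangentSpace 𝓘(ℝ, E) x :=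
  if i = j then 0
  else if j = k then
    if i = j.star then
      (1 / 2 : ℝ) •
        (S.proj k x (g.sharp x (lieDeriv X (g.flat Y) x + lieDeriv Y (g.flat X) x))
          - S.proj k x (mlieBracket 𝓘(ℝ, E) X Y x)
          - S.proj k x (g.sharp x (mvfderiv 𝓘(ℝ, E) (fun y ↦ g.inner y (X y) (Y y)) x)))
    else
      (1 / 2 : ℝ) •
        (S.proj k x (g.sharp x (lieDeriv X (g.flat Y) x))
          - S.proj k x (mlieBracket 𝓘(ℝ, E) X Y x))
  else 0

/-- The projection onto `V_{i^*j^*}^⊥ = (V_{i^*} + V_{j^*})^⊥`, that is, onto the sum of the `V_k`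
with `k ≠ i, j`. -/
def WittStructure.projPerp (S : WittStructure g r s) (i j : Index r s) (x : M)
    (v : TangentSpace 𝓘(ℝ, E) x) : TangentSpace 𝓘(ℝ, E) x :=
  ∑ k ∈ Finset.univ.filter (fun k ↦ k ≠ i ∧ k ≠ j), S.proj k x v

/-- A pseudo-Riemannian connection: `∇ g = 0`. -/
def IsPseudoRiemannianConnection (g : PseudoRiemannianMetric E M) (D : Connection E M) : Prop :=
  ∀ W : Set M, IsOpen W → ∀ Y Z : VField E M, SmoothFieldOn Y W → SmoothFieldOn Z W →
    ∀ x ∈ W, ∀ v : TangentSpace 𝓘(ℝ, E) x,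
      mvfderiv 𝓘(ℝ, E) (fun y ↦ g.inner y (Y y) (Z y)) x v
        = g.inner x (D Y x v) (Z x) + g.inner x (Y x) (D Z x v)

/-- A Witt connection: a pseudo-Riemannian connection preserving each of the subbundles `V_i`. -/
structure IsWittConnection (S : WittStructure g r s) (D : Connection E M) : Prop where
  isPseudoRiemannian : IsPseudoRiemannianConnection g D
  preserves (i : Index r s) (W : Set M) (hW : IsOpen W) (Y : VField E M)
    (hY : IsSectionOn (S.V i) Y W) : ∀ x ∈ W, ∀ v : TangentSpace 𝓘(ℝ, E) x, D Y x v ∈ S.V i x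

/-- The canonical Witt connection: the Witt connection whose torsion is
`T(X_i, Y_j) = -[X_i, Y_j]_{V_{i^*j^*}^⊥} + τ^j(X_i, Y_j) - τ^i(Y_j, X_i)`. -/
structure IsCanonicalWittConnection (S : WittStructure g r s) (D : Connection E M) : Prop
    extends IsWittConnection S D where
  torsion_eq (i j : Index r s) (W : Set M) (hW : IsOpen W) (X Y : VField E M)
    (hX : IsSectionOn (S.V i) X W) (hY : IsSectionOn (S.V j) Y W) : ∀ x ∈ W,
      torsion D x (X x) (Y x)
        = - S.projPerp i j x (mlieBracket 𝓘(ℝ, E) X Y x)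
          + S.tau j i j X Y x - S.tau i j i Y X x

end Connection

section Maps

variable {E : Type*} [NormedAddCommGroup E] [NormedSpace ℝ E]
  {M : Type*} [TopologicalSpace M] [ChartedSpace E M] [IsManifold 𝓘(ℝ, E) ∞ M]

/-- A map is Witt at `x` if its differential at `x` commutes with the projections `π^i`. -/
def WittStructure.IsWittAt {g : PseudoRiemannianMetric E M} {r s : ℕ} (S : WittStructure g r s)
    (ψ : M → M) (x : M) : Prop :=
  ∀ (i : Index r s) (v : TangentSpace 𝓘(ℝ, E) x),
    mfderiv 𝓘(ℝ, E) 𝓘(ℝ, E) ψ x (S.proj i x v)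
      = S.proj i (ψ x) (mfderiv 𝓘(ℝ, E) 𝓘(ℝ, E) ψ x v)

/-- A local Witt isometry defined on the open set `U` (only the restriction of `ψ` to `U` matters):
a local diffeomorphism which is isometric and Witt at each point of `U`. Diffeomorphisms between
open subsets of `M` are a special case, and so are local diffeomorphisms of `M`. -/
structure IsLocalWittIsometry {g : PseudoRiemannianMetric E M} {r s : ℕ}
    (S : WittStructure g r s) (ψ : M → M) (U : Set M) : Prop where
  isOpen : IsOpen U
  isLocalDiffeomorphOn : IsLocalDiffeomorphOn 𝓘(ℝ, E) 𝓘(ℝ, E) ∞ ψ U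
  isWittAt : ∀ x ∈ U, S.IsWittAt ψ x
  isometric : ∀ x ∈ U, ∀ v w : TangentSpace 𝓘(ℝ, E) x,
    g.inner (ψ x) (mfderiv 𝓘(ℝ, E) 𝓘(ℝ, E) ψ x v) (mfderiv 𝓘(ℝ, E) 𝓘(ℝ, E) ψ x w)
      = g.inner x v w

/-- The push-forward `Φ_* Y = dΦ(Y)` of the vector field `Y` under a diffeomorphism `Φ` between open
subsets; its value at a point `y` of the target is `dΦ (Y (Φ⁻¹ y))`. -/
def pushforward (Φ : PartialDiffeomorph 𝓘(ℝ, E) 𝓘(ℝ, E) M M ∞) (Y : VField E M) : VField E M :=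
  mpullback 𝓘(ℝ, E) 𝓘(ℝ, E) Φ.symm Y

/-- The connection `Φ^*∇`, `(Φ^*∇)_v Y = dΦ⁻¹ (∇_{dΦ(v)} Φ_* Y)`, on the source of `Φ`. -/
def pullbackConnection (D : Connection E M) (Φ : PartialDiffeomorph 𝓘(ℝ, E) 𝓘(ℝ, E) M M ∞)
    (Y : VField E M) (x : M) (v : TangentSpace 𝓘(ℝ, E) x) : TangentSpace 𝓘(ℝ, E) x :=
  (mfderiv 𝓘(ℝ, E) 𝓘(ℝ, E) Φ x).inverse
    (D (pushforward Φ Y) (Φ x) (mfderiv 𝓘(ℝ, E) 𝓘(ℝ, E) Φ x v))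

/-- The tensor `∇dΦ`, `(∇_v dΦ)(Y) = ∇_{dΦ(v)} dΦ(Y) - dΦ(∇_v Y)`, on the source of `Φ`. -/
def covDerivDifferential (D : Connection E M) (Φ : PartialDiffeomorph 𝓘(ℝ, E) 𝓘(ℝ, E) M M ∞)
    (Y : VField E M) (x : M) (v : TangentSpace 𝓘(ℝ, E) x) : TangentSpace 𝓘(ℝ, E) (Φ x) :=
  D (pushforward Φ Y) (Φ x) (mfderiv 𝓘(ℝ, E) 𝓘(ℝ, E) Φ x v)
    - mfderiv 𝓘(ℝ, E) 𝓘(ℝ, E) Φ x (D Y x v)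

/-- `Φ` is a restriction of `ψ` to an open subset of `U` which it maps diffeomorphically onto an
open subset of `M`. -/
def IsRestriction (Φ : PartialDiffeomorph 𝓘(ℝ, E) 𝓘(ℝ, E) M M ∞) (ψ : M → M) (U : Set M) : Prop :=
  Φ.source ⊆ U ∧ EqOn ψ Φ Φ.source

/-- `ψ^*∇ = ∇` on `U`, where `ψ^*∇` is computed with the diffeomorphisms onto open subsets to which
the local diffeomorphism `ψ` restricts. -/
def PreservesConnection (D : Connection E M) (ψ : M → M) (U : Set M) : Prop :=
  ∀ Φ : PartialDiffeomorph 𝓘(ℝ, E) 𝓘(ℝ, E) M M ∞, IsRestriction Φ ψ U →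
    ∀ W : Set M, IsOpen W → ∀ Y : VField E M, SmoothFieldOn Y W →
      ∀ x ∈ Φ.source ∩ W, ∀ v : TangentSpace 𝓘(ℝ, E) x,
        pullbackConnection D Φ Y x v = D Y x v

/-- `∇dψ = 0` on `U`. -/
def CovDerivDifferentialVanishes (D : Connection E M) (ψ : M → M) (U : Set M) : Prop :=
  ∀ Φ : PartialDiffeomorph 𝓘(ℝ, E) 𝓘(ℝ, E) M M ∞, IsRestriction Φ ψ U →
    ∀ W : Set M, IsOpen W → ∀ Y : VField E M, SmoothFieldOn Y W →
      ∀ x ∈ Φ.source ∩ W, ∀ v : TangentSpace 𝓘(ℝ, E) x,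
        covDerivDifferential D Φ Y x v = 0

/-- A local Witt affine diffeomorphism defined on the open set `U`: a local diffeomorphism which is
Witt at each point of `U` and satisfies `ψ^*∇ = ∇` on `U`. -/
structure IsLocalWittAffineDiffeo {g : PseudoRiemannianMetric E M} {r s : ℕ}
    (S : WittStructure g r s) (D : Connection E M) (ψ : M → M) (U : Set M) : Prop where
  isOpen : IsOpen U
  isLocalDiffeomorphOn : IsLocalDiffeomorphOn 𝓘(ℝ, E) 𝓘(ℝ, E) ∞ ψ U
  isWittAt : ∀ x ∈ U, S.IsWittAt ψ x
  preservesConnection : PreservesConnection D ψ U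

end Maps

end WittGeometry

end

/-! The argument is the uniqueness half of the fundamental theorem of pseudo-Riemannian geometry,
with a prescribed torsion in place of zero torsion. Let `Φ` be a restriction of `ψ` to a
diffeomorphism between open sets. The difference of `Φ^*∇` and `∇` is a tensor `A`
(`connectionDiff`), and two properties force it to vanish.

Both connections are metric, because `Φ` is an isometry; hence `A` is skew for `g`
(`connectionDiff_skew`). Both also have the same torsion: the formula for the torsion of sections of
`V_i` and `V_j` uses only brackets, Lie derivatives of 1-forms, musical isomorphisms and the
projections `π^i`, and all of these commute with a Witt isometry (`IsWitt.tau_pushforward`,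
`mlieBracket_pushforward`, `IsWitt.projPerp_differential`). Hence `A` is symmetric
(`connectionDiff_symm`). A form symmetric in one pair of arguments and skew in another is zero
(`eq_zero_of_symm_of_skew`), and non-degeneracy of `g` gives `A = 0`. -/

namespace WittGeometry

/-! ### Push-forward of functions, vector fields and brackets. -/

section Pushforward

variable {E : Type*} [NormedAddCommGroup E] [NormedSpace ℝ E]
  {M : Type*} [TopologicalSpace M] [ChartedSpace E M]

variable (Φ : PartialDiffeomorph 𝓘(ℝ, E) 𝓘(ℝ, E) M M ∞)

/-- The differential of a partial diffeomorphism at a point of its source. -/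
noncomputable def differential {x : M} (hx : x ∈ Φ.source) :
    TangentSpace 𝓘(ℝ, E) x ≃L[ℝ] TangentSpace 𝓘(ℝ, E) (Φ x) :=
  (Φ.isLocalDiffeomorphAt (x := x) _ _ _ hx).mfderivToContinuousLinearEquiv (by simp)

lemma coe_differential {x : M} (hx : x ∈ Φ.source) :
    (differential Φ hx : TangentSpace 𝓘(ℝ, E) x →L[ℝ] TangentSpace 𝓘(ℝ, E) (Φ x))
      = mfderiv 𝓘(ℝ, E) 𝓘(ℝ, E) Φ x := rfl

lemma differential_apply {x : M} (hx : x ∈ Φ.source) (v : TangentSpace 𝓘(ℝ, E) x) :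
    differential Φ hx v = mfderiv 𝓘(ℝ, E) 𝓘(ℝ, E) Φ x v := rfl

lemma inverse_mfderiv {x : M} (hx : x ∈ Φ.source) :
    (mfderiv 𝓘(ℝ, E) 𝓘(ℝ, E) Φ x).inverse = (differential Φ hx).symm := by
  rw [← coe_differential Φ hx, ContinuousLinearMap.inverse_equiv]

lemma symm_apply_apply {x : M} (hx : x ∈ Φ.source) : Φ.symm (Φ x) = x := Φ.left_inv hx

lemma mfderiv_symm_comp_mfderiv {x : M} (hx : x ∈ Φ.source) (v : TangentSpace 𝓘(ℝ, E) x) :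
    mfderiv 𝓘(ℝ, E) 𝓘(ℝ, E) Φ.symm (Φ x) (mfderiv 𝓘(ℝ, E) 𝓘(ℝ, E) Φ x v) = v := by
  have h : (Φ.symm ∘ Φ : M → M) =ᶠ[𝓝 x] id :=
    Filter.eventuallyEq_of_mem (Φ.open_source.mem_nhds hx) fun y hy ↦ Φ.left_inv hy
  have h₁ : MDifferentiableAt 𝓘(ℝ, E) 𝓘(ℝ, E) Φ.symm (Φ x) :=
    Φ.symm.mdifferentiableAt (by simp) (Φ.map_source hx)
  have h₂ : MDifferentiableAt 𝓘(ℝ, E) 𝓘(ℝ, E) Φ x := Φ.mdifferentiableAt (by simp) hx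
  have := mfderiv_comp_apply x h₁ h₂ v
  rw [← this, h.mfderiv_eq, mfderiv_id]
  rfl

/-- The push-forward is a pullback along `Φ.symm`, so its value involves the inverse of the
differential of `Φ.symm`; the chain rule identifies this with the differential of `Φ`. -/
lemma pushforward_apply (Y : VField E M) {x : M} (hx : x ∈ Φ.source) :
    pushforward Φ Y (Φ x) = differential Φ hx (Y x) := by
  have hy : Φ x ∈ Φ.symm.source := Φ.map_source hx
  rw [pushforward, mpullback_apply, inverse_mfderiv Φ.symm hy,
    symm_apply_apply Φ hx]
  refine (ContinuousLinearEquiv.symm_apply_eq (differential Φ.symm hy)).2 ?_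
  exact (mfderiv_symm_comp_mfderiv Φ hx (Y x)).symm

lemma pushforward_add (Y Z : VField E M) :
    pushforward Φ (Y + Z) = pushforward Φ Y + pushforward Φ Z := mpullback_add

lemma pushforward_smul (f : M → ℝ) (Y : VField E M) :
    pushforward Φ (f • Y) = (f ∘ Φ.symm) • pushforward Φ Y := mpullback_smul

lemma contMDiffAt_symm {y : M} (hy : y ∈ Φ.target) :
    ContMDiffAt 𝓘(ℝ, E) 𝓘(ℝ, E) ∞ Φ.symm y :=
  (Φ.symm.contMDiffOn y hy).contMDiffAt (Φ.open_target.mem_nhds hy)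

lemma isInvertible_mfderiv_symm {y : M} (hy : y ∈ Φ.target) :
    (mfderiv 𝓘(ℝ, E) 𝓘(ℝ, E) Φ.symm y).IsInvertible :=
  ⟨differential Φ.symm hy, rfl⟩

lemma isOpen_image_inter {W : Set M} (hW : IsOpen W) : IsOpen (Φ '' (Φ.source ∩ W)) :=
  Φ.toOpenPartialHomeomorph.isOpen_image_source_inter hW

lemma mvfderiv_differential {f h : M → ℝ} {x : M} (hx : x ∈ Φ.source)
    (hh : MDifferentiableAt 𝓘(ℝ, E) 𝓘(ℝ, ℝ) h (Φ x)) (hfh : ∀ᶠ y in 𝓝 x, h (Φ y) = f y)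
    (v : TangentSpace 𝓘(ℝ, E) x) :
    mvfderiv 𝓘(ℝ, E) h (Φ x) (differential Φ hx v) = mvfderiv 𝓘(ℝ, E) f x v := by
  have h₁ : (h ∘ Φ) =ᶠ[𝓝 x] f := hfh
  have h₂ := mvfderiv_comp_apply x hh (Φ.mdifferentiableAt (by simp) hx) v
  rw [differential_apply, ← h₂, mvfderiv, mvfderiv, h₁.mfderiv_eq]
  rfl

variable [IsManifold 𝓘(ℝ, E) ∞ M]

/-- Differentiability of a vector field at a point. -/
abbrev DifferentiableFieldAt (X : VField E M) (x : M) : Prop :=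
  MDifferentiableAt 𝓘(ℝ, E) (𝓘(ℝ, E).prod 𝓘(ℝ, E))
    (fun y ↦ TotalSpace.mk' E (E := fun z : M ↦ TangentSpace 𝓘(ℝ, E) z) y (X y)) x

lemma SmoothFieldOn.differentiableFieldAt {X : VField E M} {W : Set M} (hX : SmoothFieldOn X W)
    (hW : IsOpen W) {x : M} (hx : x ∈ W) : DifferentiableFieldAt X x :=
  ((hX x hx).contMDiffAt (hW.mem_nhds hx)).mdifferentiableAt (by simp)

lemma differentiableFieldAt_pushforward [CompleteSpace E] {Y : VField E M} {x : M}
    (hx : x ∈ Φ.source) (hY : DifferentiableFieldAt Y x) :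
    DifferentiableFieldAt (pushforward Φ Y) (Φ x) := by
  have hy : Φ x ∈ Φ.target := Φ.map_source hx
  refine MDifferentiableAt.mpullback_vectorField (n := ∞) ?_ (contMDiffAt_symm Φ hy)
    (isInvertible_mfderiv_symm Φ hy) ENat.LEInfty.out
  rwa [symm_apply_apply Φ hx]

lemma SmoothFieldOn.pushforward [CompleteSpace E] {Y : VField E M} {W : Set M} (hW : IsOpen W)
    (hY : SmoothFieldOn Y W) : SmoothFieldOn (pushforward Φ Y) (Φ '' (Φ.source ∩ W)) := by
  rintro _ ⟨x, ⟨hx, hxW⟩, rfl⟩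
  have hy : Φ x ∈ Φ.target := Φ.map_source hx
  refine (ContMDiffAt.mpullback_vectorField_preimage (n := ∞) ?_ (contMDiffAt_symm Φ hy)
    (isInvertible_mfderiv_symm Φ hy) le_rfl).contMDiffWithinAt
  rw [symm_apply_apply Φ hx]
  exact (hY x hxW).contMDiffAt (hW.mem_nhds hxW)

lemma mlieBracket_pushforward [CompleteSpace E] {X Y : VField E M} {x : M} (hx : x ∈ Φ.source)
    (hX : DifferentiableFieldAt X x) (hY : DifferentiableFieldAt Y x) :
    mlieBracket 𝓘(ℝ, E) (pushforward Φ X) (pushforward Φ Y) (Φ x)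
      = differential Φ hx (mlieBracket 𝓘(ℝ, E) X Y x) := by
  have hy : Φ x ∈ Φ.target := Φ.map_source hx
  -- Over `ℝ`, `minSmoothness ℝ 2` is just `2`.
  have : IsManifold 𝓘(ℝ, E) (minSmoothness ℝ 2) M := by
    rw [minSmoothness_of_isRCLikeNormedField]
    infer_instance
  rw [← pushforward_apply Φ (mlieBracket 𝓘(ℝ, E) X Y) hx]
  refine (mpullback_mlieBracket (n := ∞) ?_ ?_ (contMDiffAt_symm Φ hy) ?_).symm
  · rwa [symm_apply_apply Φ hx]
  · rwa [symm_apply_apply Φ hx]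
  · simpa using ENat.LEInfty.out

end Pushforward

/-! ### The metric, the Lie derivative of `Y^♭`, and the musical isomorphisms. -/

section Metric

variable {E : Type*} [NormedAddCommGroup E] [NormedSpace ℝ E]
  {M : Type*} [TopologicalSpace M] [ChartedSpace E M] [IsManifold 𝓘(ℝ, E) ∞ M]
  (g : PseudoRiemannianMetric E M)

lemma PseudoRiemannianMetric.mdifferentiableAt_inner {X Y : VField E M} {x : M}
    (hX : DifferentiableFieldAt X x) (hY : DifferentiableFieldAt Y x) :
    MDifferentiableAt 𝓘(ℝ, E) 𝓘(ℝ, ℝ) (fun y ↦ g.inner y (X y) (Y y)) x := by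
  have hg := (g.contMDiff x).mdifferentiableAt (by simp)
  have := MDifferentiableAt.clm_bundle_apply₂ (F₁ := E) (F₂ := E) (F₃ := ℝ)
    (E₁ := fun z : M ↦ TangentSpace 𝓘(ℝ, E) z) (E₂ := fun z : M ↦ TangentSpace 𝓘(ℝ, E) z)
    (E₃ := Trivial M ℝ) hg hX hY
  rw [mdifferentiableAt_totalSpace] at this
  exact this.2

/-- When `Z` is multiplied by `f`, the terms `X(f) g(Y, Z)` coming from the derivative and from the
bracket cancel. This shows that `lieDeriv` of `Y^♭` is not in its default branch `0`. -/
lemma tensorialAt_lieDerivAux [CompleteSpace E] (X : VField E M) {Y : VField E M} {x : M}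
    (hY : DifferentiableFieldAt Y x) :
    TensorialAt 𝓘(ℝ, E) E (lieDerivAux X (fun y ↦ g.inner y (Y y)) x) x where
  smul {f Z} hf hZ := by
    have h := g.mdifferentiableAt_inner hY hZ
    have : (fun y ↦ g.inner y (Y y) ((f • Z) y)) = f * (fun y ↦ g.inner y (Y y) (Z y)) := by
      ext y; simp
    simp only [lieDerivAux, this, mvfderiv_mul hf h, mlieBracket_smul_right hf hZ]
    simp
    ring
  add {Z Z'} hZ hZ' := by
    have : (fun y ↦ g.inner y (Y y) ((Z + Z') y))
      = (fun y ↦ g.inner y (Y y) (Z y)) + (fun y ↦ g.inner y (Y y) (Z' y)) := by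
      ext y; simp
    simp only [lieDerivAux, this, mlieBracket_add_right hZ hZ',
      mvfderiv_add (g.mdifferentiableAt_inner hY hZ) (g.mdifferentiableAt_inner hY hZ')]
    simp
    ring

lemma PseudoRiemannianMetric.eq_of_inner_eq {x : M} {u v : TangentSpace 𝓘(ℝ, E) x}
    (h : ∀ w, g.inner x u w = g.inner x v w) : u = v :=
  sub_eq_zero.1 <| g.nondegenerate x _ fun w ↦ by simp [h w]

variable [FiniteDimensional ℝ E]

lemma lieDeriv_flat_apply {X Y Z : VField E M} {x : M}
    (hY : DifferentiableFieldAt Y x) (hZ : DifferentiableFieldAt Z x) :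
    lieDeriv X (g.flat Y) x (Z x) = lieDerivAux X (g.flat Y) x Z := by
  have : CompleteSpace E := FiniteDimensional.complete ℝ E
  have h : TensorialAt 𝓘(ℝ, E) E (lieDerivAux X (g.flat Y) x) x := tensorialAt_lieDerivAux g X hY
  rw [lieDeriv, dif_pos h]
  exact TensorialAt.mkHom_apply h hZ

lemma PseudoRiemannianMetric.inner_sharp (x : M) (φ : TangentSpace 𝓘(ℝ, E) x →L[ℝ] ℝ)
    (w : TangentSpace 𝓘(ℝ, E) x) : g.inner x (g.sharp x φ) w = φ w :=
  congrArg (fun α : TangentSpace 𝓘(ℝ, E) x →L[ℝ] ℝ ↦ α w) ((g.flatEquiv x).apply_symm_apply φ)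

end Metric

/-! ### Naturality of the ingredients of the torsion formula under Witt isometries. -/

section Naturality

variable {E : Type*} [NormedAddCommGroup E] [NormedSpace ℝ E]
  {M : Type*} [TopologicalSpace M] [ChartedSpace E M] [IsManifold 𝓘(ℝ, E) ∞ M]
  {g : PseudoRiemannianMetric E M} {r s : ℕ} {S : WittStructure g r s}
  {Φ : PartialDiffeomorph 𝓘(ℝ, E) 𝓘(ℝ, E) M M ∞}

/-- The differentials of `Φ` are isometries. -/
def IsIsometric (g : PseudoRiemannianMetric E M)
    (Φ : PartialDiffeomorph 𝓘(ℝ, E) 𝓘(ℝ, E) M M ∞) : Prop :=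
  ∀ (x : M) (hx : x ∈ Φ.source) (v w : TangentSpace 𝓘(ℝ, E) x),
    g.inner (Φ x) (differential Φ hx v) (differential Φ hx w) = g.inner x v w

/-- The differentials of `Φ` commute with the projections of the Witt structure. -/
def IsWitt (S : WittStructure g r s) (Φ : PartialDiffeomorph 𝓘(ℝ, E) 𝓘(ℝ, E) M M ∞) : Prop :=
  ∀ (x : M) (hx : x ∈ Φ.source) (i : Index r s) (v : TangentSpace 𝓘(ℝ, E) x),
    differential Φ hx (S.proj i x v) = S.proj i (Φ x) (differential Φ hx v)

section Metric

variable (hg : IsIsometric g Φ) {x : M} (hx : x ∈ Φ.source)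
include hg

include hx in
lemma IsIsometric.inner_pushforward (Y Z : VField E M) :
    g.inner (Φ x) (pushforward Φ Y (Φ x)) (pushforward Φ Z (Φ x)) = g.inner x (Y x) (Z x) := by
  rw [pushforward_apply Φ Y hx, pushforward_apply Φ Z hx, hg x hx]

variable [FiniteDimensional ℝ E]

lemma IsIsometric.mvfderiv_inner_pushforward {Y Z : VField E M} (hY : DifferentiableFieldAt Y x)
    (hZ : DifferentiableFieldAt Z x) (v : TangentSpace 𝓘(ℝ, E) x) :
    mvfderiv 𝓘(ℝ, E) (fun y ↦ g.inner y (pushforward Φ Y y) (pushforward Φ Z y)) (Φ x)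
        (differential Φ hx v)
      = mvfderiv 𝓘(ℝ, E) (fun y ↦ g.inner y (Y y) (Z y)) x v := by
  have : CompleteSpace E := FiniteDimensional.complete ℝ E
  refine mvfderiv_differential Φ hx (g.mdifferentiableAt_inner
    (differentiableFieldAt_pushforward Φ hx hY) (differentiableFieldAt_pushforward Φ hx hZ)) ?_ v
  filter_upwards [Φ.open_source.mem_nhds hx] with y hy
  exact hg.inner_pushforward hy Y Z

/-- Once `w` is extended to a field `Z`, both sides are given by `X(g(Y, Z)) - g(Y, [X, Z])`, whose
two terms are each natural under isometries. -/
lemma IsIsometric.lieDeriv_flat_pushforward {X Y : VField E M} (hX : DifferentiableFieldAt X x)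
    (hY : DifferentiableFieldAt Y x) (w : TangentSpace 𝓘(ℝ, E) x) :
    lieDeriv (pushforward Φ X) (g.flat (pushforward Φ Y)) (Φ x) (differential Φ hx w)
      = lieDeriv X (g.flat Y) x w := by
  have : CompleteSpace E := FiniteDimensional.complete ℝ E
  obtain ⟨Z, hZ, rfl⟩ : ∃ Z : VField E M, DifferentiableFieldAt Z x ∧ Z x = w :=
    ⟨FiberBundle.extend E w, FiberBundle.mdifferentiableAt_extend .., by simp⟩
  have hY' := differentiableFieldAt_pushforward Φ hx hY
  have hZ' := differentiableFieldAt_pushforward Φ hx hZ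
  rw [← pushforward_apply, lieDeriv_flat_apply g hY' hZ', lieDeriv_flat_apply g hY hZ, lieDerivAux,
    lieDerivAux, mlieBracket_pushforward Φ hx hX hZ, pushforward_apply Φ X hx]
  congr 1
  · exact hg.mvfderiv_inner_pushforward hx hY hZ _
  · rw [PseudoRiemannianMetric.flat, pushforward_apply Φ Y hx]
    exact hg x hx _ _

/-- A vector is determined by its pairings, and every test vector at `Φ x` is the image of one at
`x`. -/
lemma IsIsometric.differential_sharp {φ : TangentSpace 𝓘(ℝ, E) x →L[ℝ] ℝ}
    {φ' : TangentSpace 𝓘(ℝ, E) (Φ x) →L[ℝ] ℝ} (h : ∀ w, φ' (differential Φ hx w) = φ w) :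
    differential Φ hx (g.sharp x φ) = g.sharp (Φ x) φ' := by
  refine g.eq_of_inner_eq fun w ↦ ?_
  obtain ⟨w, rfl⟩ := (differential Φ hx).surjective w
  rw [hg x hx, g.inner_sharp, g.inner_sharp, h]

end Metric

section Projections

lemma WittStructure.proj_apply_mem (S : WittStructure g r s) (i : Index r s) (x : M)
    (v : TangentSpace 𝓘(ℝ, E) x) : S.proj i x v ∈ S.V i x := by
  simp [WittStructure.proj]

lemma WittStructure.proj_apply_of_mem (S : WittStructure g r s) {i : Index r s} {x : M}
    {v : TangentSpace 𝓘(ℝ, E) x} (hv : v ∈ S.V i x) : S.proj i x v = v := by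
  have : (LinearEquiv.ofBijective (DirectSum.coeLinearMap fun j ↦ S.V j x)
      (S.isInternal x)).symm v = DirectSum.lof ℝ _ (fun j ↦ S.V j x) i ⟨v, hv⟩ := by
    refine (LinearEquiv.symm_apply_eq _).2 ?_
    exact (DirectSum.coeLinearMap_lof (fun j ↦ S.V j x) i ⟨v, hv⟩).symm
  simp only [WittStructure.proj, LinearMap.comp_apply, LinearEquiv.coe_coe, this]
  simp [DirectSum.component.lof_self]

lemma IsWitt.differential_mem (hS : IsWitt S Φ) {x : M} (hx : x ∈ Φ.source) {i : Index r s}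
    {v : TangentSpace 𝓘(ℝ, E) x} (hv : v ∈ S.V i x) : differential Φ hx v ∈ S.V i (Φ x) := by
  rw [← S.proj_apply_of_mem hv, hS]
  exact S.proj_apply_mem i _ _

variable (hS : IsWitt S Φ) {x : M} (hx : x ∈ Φ.source)

include hS in
lemma IsWitt.projPerp_differential (i j : Index r s) (v : TangentSpace 𝓘(ℝ, E) x) :
    S.projPerp i j (Φ x) (differential Φ hx v) = differential Φ hx (S.projPerp i j x v) := by
  simp only [WittStructure.projPerp, map_sum, hS x hx]

variable [FiniteDimensional ℝ E]

lemma IsSectionOn.pushforward (hS : IsWitt S Φ) {i : Index r s} {W : Set M} (hW : IsOpen W)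
    {X : VField E M} (hX : IsSectionOn (S.V i) X W) :
    IsSectionOn (S.V i) (pushforward Φ X) (Φ '' (Φ.source ∩ W)) := by
  have : CompleteSpace E := FiniteDimensional.complete ℝ E
  refine ⟨hX.1.pushforward Φ hW, ?_⟩
  rintro _ ⟨x, ⟨hx, hxW⟩, rfl⟩
  rw [pushforward_apply Φ X hx]
  exact hS.differential_mem hx (hX.2 x hxW)

include hS in
lemma IsWitt.tau_pushforward (hg : IsIsometric g Φ) (k i j : Index r s) {X Y : VField E M}
    (hX : DifferentiableFieldAt X x) (hY : DifferentiableFieldAt Y x) :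
    S.tau k i j (pushforward Φ X) (pushforward Φ Y) (Φ x)
      = differential Φ hx (S.tau k i j X Y x) := by
  have : CompleteSpace E := FiniteDimensional.complete ℝ E
  have hXY := hg.lieDeriv_flat_pushforward hx hX hY
  have hYX := hg.lieDeriv_flat_pushforward hx hY hX
  have h₁ : ∀ w, (lieDeriv (pushforward Φ X) (g.flat (pushforward Φ Y)) (Φ x)
      + lieDeriv (pushforward Φ Y) (g.flat (pushforward Φ X)) (Φ x)) (differential Φ hx w)
      = (lieDeriv X (g.flat Y) x + lieDeriv Y (g.flat X) x) w := fun w ↦ by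
    simp [hXY, hYX]
  have h₂ := hg.mvfderiv_inner_pushforward hx hX hY
  unfold WittStructure.tau
  rw [mlieBracket_pushforward Φ hx hX hY, ← hg.differential_sharp hx h₁,
    ← hg.differential_sharp hx hXY, ← hg.differential_sharp hx h₂]
  -- The case conditions involve only the indices, so both sides fall in the same branch; there,
  -- only the projections remain to be moved past the differential.
  split_ifs <;> simp only [map_smul, map_sub, map_zero, hS x hx]

end Projections

end Naturality

/-! ### The difference tensor of `Φ^*∇` and `∇`, and its vanishing. -/

section Uniqueness

variable {E : Type*} [NormedAddCommGroup E] [NormedSpace ℝ E]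
  {M : Type*} [TopologicalSpace M] [ChartedSpace E M] [IsManifold 𝓘(ℝ, E) ∞ M]
  {g : PseudoRiemannianMetric E M} {r s : ℕ} {S : WittStructure g r s} {D : Connection E M}
  {Φ : PartialDiffeomorph 𝓘(ℝ, E) 𝓘(ℝ, E) M M ∞}

/-- Every vector tangent to a smooth subbundle is the value of a smooth local section. -/
lemma IsSmoothSubbundle.exists_isSectionOn {V : Π x : M, Submodule ℝ (TangentSpace 𝓘(ℝ, E) x)}
    {k : ℕ} (hV : IsSmoothSubbundle V k) {x : M} {v : TangentSpace 𝓘(ℝ, E) x} (hv : v ∈ V x) :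
    ∃ (W : Set M) (X : VField E M), IsOpen W ∧ x ∈ W ∧ IsSectionOn V X W ∧ X x = v := by
  obtain ⟨W, hW, hxW, e, he, hspan⟩ := hV x
  rw [← (hspan x hxW).2, Submodule.mem_span_range_iff_exists_fun] at hv
  obtain ⟨c, rfl⟩ := hv
  -- The coefficients of `v` in the frame at `x` are kept constant.
  refine ⟨W, fun y ↦ ∑ a, c a • e a y, hW, hxW, ⟨?_, fun y hy ↦ ?_⟩, rfl⟩
  · exact ContMDiffOn.sum_section fun a _ ↦ (he a).const_smul_section
  · rw [← (hspan y hy).2]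
    exact Submodule.sum_mem _ fun a _ ↦ Submodule.smul_mem _ _ (Submodule.subset_span ⟨a, rfl⟩)

lemma SmoothFieldOn.mono {X : VField E M} {W W' : Set M} (hX : SmoothFieldOn X W) (h : W' ⊆ W) :
    SmoothFieldOn X W' := ContMDiffOn.mono hX h

lemma IsSectionOn.mono {V : Π x : M, Submodule ℝ (TangentSpace 𝓘(ℝ, E) x)} {X : VField E M}
    {W W' : Set M} (hX : IsSectionOn V X W) (h : W' ⊆ W) : IsSectionOn V X W' :=
  ⟨hX.1.mono h, fun y hy ↦ hX.2 y (h hy)⟩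

/-- Every tangent vector is the value of a smooth local vector field. -/
lemma exists_smoothFieldOn {x : M} (v : TangentSpace 𝓘(ℝ, E) x) :
    ∃ (W : Set M) (X : VField E M), IsOpen W ∧ x ∈ W ∧ SmoothFieldOn X W ∧ X x = v := by
  obtain ⟨W, hW, h⟩ := FiberBundle.exists_contMDiffOn_extend 𝓘(ℝ, E) E (k := ∞) v
  obtain ⟨W', hW'W, hW', hxW'⟩ := mem_nhds_iff.1 hW
  exact ⟨W', FiberBundle.extend E v, hW', hxW', h.mono hW'W, by simp⟩

/-- The difference at `x` of the pulled back connection `Φ^*∇` and of `∇`, as an operation on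
vector fields. -/
noncomputable def connectionDiffAux (D : Connection E M) {x : M} (hx : x ∈ Φ.source)
    (Y : VField E M) : TangentSpace 𝓘(ℝ, E) x →L[ℝ] TangentSpace 𝓘(ℝ, E) x :=
  ((differential Φ hx).symm : TangentSpace 𝓘(ℝ, E) (Φ x) →L[ℝ] TangentSpace 𝓘(ℝ, E) x) ∘L
    D (pushforward Φ Y) (Φ x) ∘L
      (differential Φ hx : TangentSpace 𝓘(ℝ, E) x →L[ℝ] TangentSpace 𝓘(ℝ, E) (Φ x)) - D Y x

lemma connectionDiffAux_apply {x : M} (hx : x ∈ Φ.source) (Y : VField E M)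
    (v : TangentSpace 𝓘(ℝ, E) x) :
    connectionDiffAux D hx Y v = (differential Φ hx).symm
      (D (pushforward Φ Y) (Φ x) (differential Φ hx v)) - D Y x v := rfl

variable [FiniteDimensional ℝ E]

/-- The function `f` is transported to `f ∘ Φ.symm`, whose derivative along the image of `v` is
`df(v)`; the two Leibniz terms `df(v) Y` therefore cancel. -/
lemma tensorialAt_connectionDiffAux {x : M} (hx : x ∈ Φ.source) :
    TensorialAt 𝓘(ℝ, E) E (connectionDiffAux (Φ := Φ) D hx) x where
  smul {f Y} hf hY := by
    have : CompleteSpace E := FiniteDimensional.complete ℝ E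
    have hf' : MDifferentiableAt 𝓘(ℝ, E) 𝓘(ℝ, ℝ) (f ∘ Φ.symm) (Φ x) := by
      refine MDifferentiableAt.comp (Φ x) (g := f) ?_
        ((contMDiffAt_symm Φ (Φ.map_source hx)).mdifferentiableAt (by simp))
      rwa [symm_apply_apply Φ hx]
    have hfx : (f ∘ Φ.symm) (Φ x) = f x := congrArg f (symm_apply_apply Φ hx)
    have hd (v) := mvfderiv_differential (f := f) Φ hx hf' (by
      filter_upwards [Φ.open_source.mem_nhds hx] with y hy
      exact congrArg f (symm_apply_apply Φ hy)) v
    ext v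
    rw [smul_apply, connectionDiffAux_apply, connectionDiffAux_apply,
      pushforward_smul, D.isCovariantDerivativeOn.leibniz hY hf,
      D.isCovariantDerivativeOn.leibniz (differentiableFieldAt_pushforward Φ hx hY) hf']
    simp only [add_apply, smul_apply,
      ContinuousLinearMap.smulRight_apply, hd, hfx, pushforward_apply Φ Y hx, map_add, map_smul,
      ContinuousLinearEquiv.symm_apply_apply]
    module
  add {Y Z} hY hZ := by
    have : CompleteSpace E := FiniteDimensional.complete ℝ E
    ext v
    rw [add_apply, connectionDiffAux_apply, connectionDiffAux_apply,
      connectionDiffAux_apply, pushforward_add, D.isCovariantDerivativeOn.add hY hZ,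
      D.isCovariantDerivativeOn.add (differentiableFieldAt_pushforward Φ hx hY)
        (differentiableFieldAt_pushforward Φ hx hZ)]
    simp only [add_apply, map_add]
    abel

/-- The difference tensor at `x` of the pulled back connection `Φ^*∇` and of `∇`. -/
noncomputable def connectionDiff (D : Connection E M) {x : M} (hx : x ∈ Φ.source) :
    TangentSpace 𝓘(ℝ, E) x →L[ℝ] TangentSpace 𝓘(ℝ, E) x →L[ℝ] TangentSpace 𝓘(ℝ, E) x :=
  TensorialAt.mkHom (connectionDiffAux D hx) x (tensorialAt_connectionDiffAux hx)

/-- The first argument is the value of the differentiated field, the second the direction of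
differentiation. -/
lemma connectionDiff_apply {x : M} (hx : x ∈ Φ.source) {Y : VField E M}
    (hY : DifferentiableFieldAt Y x) (v : TangentSpace 𝓘(ℝ, E) x) :
    connectionDiff D hx (Y x) v = (differential Φ hx).symm
      (D (pushforward Φ Y) (Φ x) (differential Φ hx v)) - D Y x v :=
  congrArg (fun A : TangentSpace 𝓘(ℝ, E) x →L[ℝ] TangentSpace 𝓘(ℝ, E) x ↦ A v)
    (TensorialAt.mkHom_apply (tensorialAt_connectionDiffAux hx) hY)

/-- A trilinear form that is symmetric in the first two and skew in the outer two arguments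
vanishes. -/
lemma eq_zero_of_symm_of_skew {V : Type*} {C : V → V → V → ℝ} (hs : ∀ u v w, C u v w = C v u w)
    (ha : ∀ u v w, C u v w = -C w v u) (u v w : V) : C u v w = 0 := by
  -- Alternating the two symmetries leads back to `C u v w` after six transpositions, three of which
  -- change the sign, so `C u v w = -C u v w`.
  have h₁ := ha u v w
  have h₂ := hs w v u
  have h₃ := ha v w u
  have h₄ := hs u w v
  have h₅ := ha w u v
  have h₆ := hs v u w
  linarith

lemma torsion_apply (D : Connection E M) {X Y : VField E M} {x : M}
    (hX : DifferentiableFieldAt X x) (hY : DifferentiableFieldAt Y x) :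
    torsion D x (X x) (Y x) = D Y x (X x) - D X x (Y x) - mlieBracket 𝓘(ℝ, E) X Y x := by
  have : CompleteSpace E := FiniteDimensional.complete ℝ E
  exact CovariantDerivative.torsion_apply D hX hY

variable {x : M} (hx : x ∈ Φ.source) (hg : IsIsometric g Φ)

include hg in
-- The derivative of `g(Y, Z)` along `v` is expanded at `x` and, after push-forward, at `Φ x`; the
-- difference of the two expansions is the skewness relation.
lemma IsPseudoRiemannianConnection.connectionDiff_skew (hD : IsPseudoRiemannianConnection g D)
    (u v w : TangentSpace 𝓘(ℝ, E) x) :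
    g.inner x (connectionDiff D hx u v) w = -g.inner x (connectionDiff D hx w v) u := by
  have : CompleteSpace E := FiniteDimensional.complete ℝ E
  obtain ⟨W₁, Y, hW₁, hxW₁, hY, rfl⟩ := exists_smoothFieldOn u
  obtain ⟨W₂, Z, hW₂, hxW₂, hZ, rfl⟩ := exists_smoothFieldOn w
  have hYx := hY.differentiableFieldAt hW₁ hxW₁
  have hZx := hZ.differentiableFieldAt hW₂ hxW₂
  have hW := hW₁.inter hW₂
  have hY' := hY.mono (inter_subset_left (t := W₂))
  have hZ' := hZ.mono (inter_subset_right (s := W₁))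
  have h := hD _ hW Y Z hY' hZ' x ⟨hxW₁, hxW₂⟩ v
  have h' := hD _ (isOpen_image_inter Φ hW) _ _ (hY'.pushforward Φ hW) (hZ'.pushforward Φ hW)
    (Φ x) ⟨x, ⟨hx, hxW₁, hxW₂⟩, rfl⟩ (differential Φ hx v)
  rw [hg.mvfderiv_inner_pushforward hx hYx hZx, h, pushforward_apply Φ Y hx,
    pushforward_apply Φ Z hx] at h'
  -- Here `a` and `b` are the `Φ^*∇`-derivatives of `Y` and `Z`; with them the isometry property
  -- brings the pairings at `Φ x` back to `x`.
  obtain ⟨a, ha⟩ := (differential Φ hx).surjective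
    (D (pushforward Φ Y) (Φ x) (differential Φ hx v))
  obtain ⟨b, hb⟩ := (differential Φ hx).surjective
    (D (pushforward Φ Z) (Φ x) (differential Φ hx v))
  rw [← ha, ← hb, hg x hx, hg x hx] at h'
  rw [connectionDiff_apply hx hYx, connectionDiff_apply hx hZx, ← ha, ← hb,
    ContinuousLinearEquiv.symm_apply_apply, ContinuousLinearEquiv.symm_apply_apply, map_sub,
    map_sub, sub_apply, sub_apply, g.symm x b,
    g.symm x (D Z x v)]
  linarith

variable (hS : IsWitt S Φ)
include hg hS

/-- The antisymmetric part of the difference tensor measures the difference of the torsions, since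
the bracket terms agree. The torsion formula applies only to sections of the `V_i`; the Witt
property ensures that push-forwards are again such sections. -/
lemma IsCanonicalWittConnection.connectionDiff_symm_of_mem (hD : IsCanonicalWittConnection S D)
    {i j : Index r s} {u v : TangentSpace 𝓘(ℝ, E) x} (hu : u ∈ S.V i x) (hv : v ∈ S.V j x) :
    connectionDiff D hx u v = connectionDiff D hx v u := by
  have : CompleteSpace E := FiniteDimensional.complete ℝ E
  obtain ⟨W₁, X, hW₁, hxW₁, hX, rfl⟩ := (S.isSmoothSubbundle i).exists_isSectionOn hu
  obtain ⟨W₂, Y, hW₂, hxW₂, hY, rfl⟩ := (S.isSmoothSubbundle j).exists_isSectionOn hv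
  have hXx := hX.1.differentiableFieldAt hW₁ hxW₁
  have hYx := hY.1.differentiableFieldAt hW₂ hxW₂
  have hW := hW₁.inter hW₂
  have hX' := hX.mono (inter_subset_left (t := W₂))
  have hY' := hY.mono (inter_subset_right (s := W₁))
  have h := hD.torsion_eq i j _ hW X Y hX' hY' x ⟨hxW₁, hxW₂⟩
  have h' := hD.torsion_eq i j _ (isOpen_image_inter Φ hW) _ _ (hX'.pushforward hS hW)
    (hY'.pushforward hS hW) (Φ x) ⟨x, ⟨hx, hxW₁, hxW₂⟩, rfl⟩
  -- By naturality, the right-hand side of the torsion formula at `Φ x` is the image of the one at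
  -- `x`, hence of the torsion at `x`.
  rw [torsion_apply D (differentiableFieldAt_pushforward Φ hx hXx)
      (differentiableFieldAt_pushforward Φ hx hYx), mlieBracket_pushforward Φ hx hXx hYx,
    hS.projPerp_differential hx, hS.tau_pushforward hx hg _ _ _ hXx hYx,
    hS.tau_pushforward hx hg _ _ _ hYx hXx, pushforward_apply Φ X hx, pushforward_apply Φ Y hx,
    ← map_neg, ← map_add, ← map_sub, ← h, torsion_apply D hXx hYx] at h'
  have h'' := congrArg (differential Φ hx).symm h'
  simp only [map_sub, ContinuousLinearEquiv.symm_apply_apply] at h''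
  rw [connectionDiff_apply hx hXx, connectionDiff_apply hx hYx, ← sub_eq_zero]
  rw [← sub_eq_zero] at h''
  rw [← neg_eq_zero, ← h'']
  abel

/-- The `V_i` span the tangent space and the difference tensor is bilinear. -/
lemma IsCanonicalWittConnection.connectionDiff_symm (hD : IsCanonicalWittConnection S D)
    (u v : TangentSpace 𝓘(ℝ, E) x) : connectionDiff D hx u v = connectionDiff D hx v u := by
  have hspan := (S.isInternal x).submodule_iSup_eq_top
  have hu : u ∈ ⨆ i, S.V i x := hspan ▸ Submodule.mem_top
  have hv : v ∈ ⨆ i, S.V i x := hspan ▸ Submodule.mem_top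
  induction hu using Submodule.iSup_induction' with
  | mem i u hu =>
    induction hv using Submodule.iSup_induction' with
    | mem j v hv => exact hD.connectionDiff_symm_of_mem hx hg hS hu hv
    | zero => simp
    | add v w _ _ hv hw => simp [hv, hw]
  | zero => simp
  | add u w _ _ hu hw => simp [hu, hw]

lemma IsCanonicalWittConnection.connectionDiff_eq_zero (hD : IsCanonicalWittConnection S D)
    (u v : TangentSpace 𝓘(ℝ, E) x) : connectionDiff D hx u v = 0 :=
  g.nondegenerate x _ fun w ↦
    eq_zero_of_symm_of_skew (C := fun u v w ↦ g.inner x (connectionDiff D hx u v) w)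
      (fun u v w ↦ by rw [hD.connectionDiff_symm hx hg hS])
      (fun u v w ↦ hD.isPseudoRiemannian.connectionDiff_skew hx hg u v w) u v w

/-- A diffeomorphism between open sets which is isometric and Witt preserves the canonical Witt
connection. -/
lemma IsCanonicalWittConnection.apply_pushforward (hD : IsCanonicalWittConnection S D)
    {Y : VField E M} (hY : DifferentiableFieldAt Y x) (v : TangentSpace 𝓘(ℝ, E) x) :
    D (pushforward Φ Y) (Φ x) (differential Φ hx v) = differential Φ hx (D Y x v) := by
  have h := connectionDiff_apply (D := D) hx hY v
  rw [hD.connectionDiff_eq_zero hx hg hS, eq_comm, sub_eq_zero] at h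
  rw [← h, ContinuousLinearEquiv.apply_symm_apply]

end Uniqueness

/-! ### From the local isometry `ψ` to its diffeomorphic restrictions. -/

section Restriction

variable {E : Type*} [NormedAddCommGroup E] [NormedSpace ℝ E]
  {M : Type*} [TopologicalSpace M] [ChartedSpace E M]
  {Φ : PartialDiffeomorph 𝓘(ℝ, E) 𝓘(ℝ, E) M M ∞} {ψ : M → M} {U : Set M}

lemma IsRestriction.mfderiv_eq (h : IsRestriction Φ ψ U) {x : M} (hx : x ∈ Φ.source) :
    mfderiv 𝓘(ℝ, E) 𝓘(ℝ, E) ψ x = mfderiv 𝓘(ℝ, E) 𝓘(ℝ, E) Φ x :=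
  (Filter.eventuallyEq_of_mem (Φ.open_source.mem_nhds hx) h.2).mfderiv_eq

variable [IsManifold 𝓘(ℝ, E) ∞ M] {g : PseudoRiemannianMetric E M} {r s : ℕ}
  {S : WittStructure g r s}

lemma IsLocalWittIsometry.isIsometric (hψ : IsLocalWittIsometry S ψ U)
    (h : IsRestriction Φ ψ U) : IsIsometric g Φ := fun x hx v w ↦ by
  have := hψ.isometric x (h.1 hx) v w
  rw [h.mfderiv_eq hx, h.2 hx] at this
  exact this

lemma IsLocalWittIsometry.isWitt (hψ : IsLocalWittIsometry S ψ U)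
    (h : IsRestriction Φ ψ U) : IsWitt S Φ := fun x hx i v ↦ by
  have := hψ.isWittAt x (h.1 hx) i v
  rw [h.mfderiv_eq hx, h.2 hx] at this
  exact this

end Restriction

end WittGeometry

theorem lemma5p1 {E : Type*} [NormedAddCommGroup E] [NormedSpace ℝ E] [FiniteDimensional ℝ E]
    {M : Type*} [TopologicalSpace M] [ChartedSpace E M] [IsManifold 𝓘(ℝ, E) ∞ M]
    {r s : ℕ} (g : WittGeometry.PseudoRiemannianMetric E M) (S : WittGeometry.WittStructure g r s)
    (D : WittGeometry.Connection E M) (hD : WittGeometry.IsCanonicalWittConnection S D)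
    (ψ : M → M) (U : Set M) (hψ : WittGeometry.IsLocalWittIsometry S ψ U) :
    WittGeometry.IsLocalWittAffineDiffeo S D ψ U ∧ WittGeometry.CovDerivDifferentialVanishes D ψ U := by
  refine ⟨⟨hψ.isOpen, hψ.isLocalDiffeomorphOn, hψ.isWittAt, ?_⟩, ?_⟩
  · intro Φ hΦ W hW Y hY x hx v
    have h := hD.apply_pushforward hx.1 (hψ.isIsometric hΦ) (hψ.isWitt hΦ)
      (hY.differentiableFieldAt hW hx.2) v
    -- On the source of `Φ`, `ContinuousLinearMap.inverse` is the true inverse of the differential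
    -- rather than its default value.
    rw [WittGeometry.pullbackConnection, WittGeometry.inverse_mfderiv Φ hx.1]
    exact (congrArg (WittGeometry.differential Φ hx.1).symm h).trans
      ((WittGeometry.differential Φ hx.1).symm_apply_apply _)
  · intro Φ hΦ W hW Y hY x hx v
    exact sub_eq_zero.2 (hD.apply_pushforward hx.1 (hψ.isIsometric hΦ) (hψ.isWitt hΦ)
      (hY.differentiableFieldAt hW hx.2) v)
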